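/- Let $d$ and $r$ be positive integers and put $\operatorname{Tv}(d,r)=(d+1)(r-1)+1$. For a finite set $S\subset\mathbb{R}^d$, a Tverberg partition of $S$ into $r$ parts is an (unordered) partition of $S$ into exactly $r$ nonempty parts whose convex hulls have a common point. Let $G_T[S,r]$ be the simple graph whose vertices are the Tverberg partitions of $S$ into $r$ parts, in which two distinct partitions $P$ and $P'$ are adjacent if and only if there is exactly one $x\in S$ such that removing $x$ from both $P$ and $P'$ gives the same partition of $S\setminus\{x\}$. Let $S\subset\mathbb{R}^d$ be a set of $n>\operatorname{Tv}(d,r)$ points. Then every vertex $v$ of $G_T[S,r]$ satisfies \[ \bigl(n+1-\operatorname{Tv}(d,r)\bigr)(r-1)\;\le\;\deg(v)\;\le\; n(r-1). \] -/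

import Mathlib

/-- The Tverberg number `Tv(d, r) = (d + 1)(r - 1) + 1`, for a number of parts `r ≥ 1`. -/
def Tv (d r : ℕ) : ℕ := (d + 1) * (r - 1) + 1

open Classical in
/-- The Tverberg partitions of a finite set `S ⊂ ℝ^d` into `r` parts: the (unordered) partitions
of `S` into exactly `r` nonempty parts whose convex hulls have a common point. -/
def TverbergPartition {d : ℕ} (S : Finset (EuclideanSpace ℝ (Fin d))) (r : ℕ) : Type :=
  {P : Finpartition S //
    P.parts.card = r ∧
      (⋂ A ∈ P.parts, convexHull ℝ (A : Set (EuclideanSpace ℝ (Fin d)))).Nonempty}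

open Classical in
/-- A finite set has only finitely many Tverberg partitions. -/
noncomputable instance TverbergPartition.instFintype {d : ℕ}
    (S : Finset (EuclideanSpace ℝ (Fin d))) (r : ℕ) : Fintype (TverbergPartition S r) :=
  inferInstanceAs (Fintype {P : Finpartition S //
    P.parts.card = r ∧
      (⋂ A ∈ P.parts, convexHull ℝ (A : Set (EuclideanSpace ℝ (Fin d)))).Nonempty})

open Classical in
/-- The Tverberg `r`-partition graph `G_T[S, r]`. Its vertices are the Tverberg partitions of `S`
into `r` parts; two distinct ones are adjacent iff there is exactly one `x ∈ S` such that removing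
`x` from both yields the same partition of `S \ {x}` (`P.avoid {x}` is the partition of `S \ {x}`
obtained from `P` by removing `x` from its part, and dropping that part if it becomes empty). -/
def tverbergGraph {d : ℕ} (S : Finset (EuclideanSpace ℝ (Fin d))) (r : ℕ) :
    SimpleGraph (TverbergPartition S r) where
  Adj P Q := P ≠ Q ∧ ∃! x, x ∈ S ∧ P.1.avoid {x} = Q.1.avoid {x}
  symm := ⟨fun _ _ h => ⟨h.1.symm, by simpa only [eq_comm] using h.2⟩⟩
  loopless := ⟨fun _ h => h.1 rfl⟩

/-- Adjacency is decidable (classically), so that degrees are defined. -/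
noncomputable instance tverbergGraph.instDecidableRel {d : ℕ}
    (S : Finset (EuclideanSpace ℝ (Fin d))) (r : ℕ) : DecidableRel (tverbergGraph S r).Adj :=
  fun _ _ => Classical.propDecidable _

/-!
Let `P` be a Tverberg partition of `S` into `r` parts. A neighbour of `P` arises by moving one point
`x` of `S`, not alone in its part, to one of the `r - 1` parts that do not contain it: two distinct
partitions with equally many parts that agree away from `x` differ in this way
(`Finpartition.part_sdiff_mem_of_avoid_eq`, `Finpartition.exists_move`), and the point `x` is
determined by the two partitions (`Finpartition.eq_of_avoid_eq_of_avoid_eq`), so the uniqueness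
required in the definition of adjacency is automatic. This gives the upper bound, and it reduces the
lower bound to finding `n + 1 - Tv(d, r)` *redundant* points: points `x` such that the convex hulls
of the parts still meet after `x` is removed. Such a point can be moved to any other part, since
every part of the new partition contains a part of `P` with `x` removed.

Redundant points are found by linear algebra (`card_sub_le_card_redundant`). Call weights on `S`
balanced if their restrictions to the parts of `P` all have the same total weight and the same
weighted vector sum. Balanced weights form a subspace `L` of `ℝ^n` of dimension at least
`n - (d + 1) (r - 1) = n + 1 - Tv(d, r) ≥ 2`. Up to scaling, nonzero nonnegative elements of `L` are
the same as common points of the convex hulls together with ways of writing them as convex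
combinations of the parts; hence `x` is redundant as soon as a nonzero nonnegative element of `L`
vanishes at `x`. Finally, a subspace of dimension at least two that contains a nonzero nonnegative
vector has at least `dim L` indices at which some such vector vanishes
(`finrank_le_card_exists_nonneg_apply_eq_zero`).
-/

/-! ### Moving one point of a finite partition to another part -/

namespace Finpartition

variable {α : Type*} [DecidableEq α] {S : Finset α}

lemma sdiff_singleton_eq_of_notMem {C : Finset α} {x : α} (hx : x ∉ C) :
    C \ {x} = C := by
  rw [Finset.sdiff_singleton_eq_erase, Finset.erase_eq_of_notMem hx]

lemma mem_avoid_singleton {P : Finpartition S} {x : α} {C : Finset α} :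
    C ∈ (P.avoid {x}).parts ↔ C.Nonempty ∧ ∃ D ∈ P.parts, D \ {x} = C := by
  rw [mem_avoid]
  constructor
  · rintro ⟨D, hD, hDx, rfl⟩
    exact ⟨Finset.sdiff_nonempty.2 hDx, D, hD, rfl⟩
  · rintro ⟨hC, D, hD, rfl⟩
    exact ⟨D, hD, Finset.sdiff_nonempty.1 hC, rfl⟩

lemma avoid_singleton_congr {P Q : Finpartition S} {x : α}
    (h : P.avoid {x} = Q.avoid {x}) {D : Finset α} (hD : D ∈ P.parts) (hDx : (D \ {x}).Nonempty) :
    ∃ D' ∈ Q.parts, D' \ {x} = D \ {x} :=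
  (mem_avoid_singleton.1 (h ▸ mem_avoid_singleton.2 ⟨hDx, D, hD, rfl⟩)).2

/-- A partition is recovered from the partition avoiding `x` and the part containing `x`. -/
lemma parts_eq_insert_avoid (Q : Finpartition S) {x : α} (hx : x ∈ S) :
    Q.parts = insert (Q.part x) ((Q.avoid {x}).parts.erase (Q.part x \ {x})) := by
  have hsub : ∀ D ∈ Q.parts, D ≠ Q.part x → D \ {x} = D := fun D hD hne ↦
    sdiff_singleton_eq_of_notMem fun hxD ↦ hne (Q.part_eq_of_mem hD hxD).symm
  ext C
  rw [Finset.mem_insert, Finset.mem_erase, mem_avoid_singleton]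
  constructor
  · intro hC
    refine or_iff_not_imp_left.2 fun hne ↦
      ⟨fun hEq ↦ ?_, Q.nonempty_of_mem_parts hC, C, hC, hsub C hC hne⟩
    obtain ⟨c, hc⟩ := Q.nonempty_of_mem_parts hC
    have hc' : c ∈ Q.part x := (Finset.mem_sdiff.1 (hEq ▸ hc)).1
    exact hne (Q.eq_of_mem_parts hC (Q.part_mem.2 hx) hc hc')
  · rintro (rfl | ⟨hne, -, D, hD, rfl⟩)
    · exact Q.part_mem.2 hx
    · rwa [hsub D hD fun h ↦ hne (by rw [h])]

lemma card_parts_eq_card_erase_avoid (Q : Finpartition S) {x : α} (hx : x ∈ S) :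
    Q.parts.card = ((Q.avoid {x}).parts.erase (Q.part x \ {x})).card + 1 := by
  conv_lhs => rw [Q.parts_eq_insert_avoid hx]
  refine Finset.card_insert_of_notMem fun h ↦ ?_
  obtain ⟨-, D, -, hD⟩ := mem_avoid_singleton.1 (Finset.mem_of_mem_erase h)
  have : x ∈ D \ {x} := hD ▸ Q.mem_part hx
  simp at this

lemma eq_of_avoid_eq_of_part_eq {P Q : Finpartition S} {x : α} (hx : x ∈ S)
    (h : P.avoid {x} = Q.avoid {x}) (hpart : P.part x \ {x} = Q.part x \ {x}) : P = Q := by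
  have hp : P.part x = Q.part x := by
    rw [← Finset.insert_sdiff_self_of_mem (P.mem_part hx),
      ← Finset.insert_sdiff_self_of_mem (Q.mem_part hx), hpart]
  ext1
  rw [P.parts_eq_insert_avoid hx, Q.parts_eq_insert_avoid hx, h, hp]

/-- If two distinct partitions with equally many parts agree away from `x`, then the companions of
`x` in the second one form a part of the first one, which does not contain `x`. -/
lemma part_sdiff_mem_of_avoid_eq {P Q : Finpartition S} {x : α} (hx : x ∈ S)
    (h : P.avoid {x} = Q.avoid {x}) (hcard : P.parts.card = Q.parts.card) (hne : P ≠ Q) :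
    Q.part x \ {x} ∈ P.parts.erase (P.part x) := by
  have hmem : Q.part x \ {x} ∈ (Q.avoid {x}).parts := by
    by_contra hQ
    have hQe : Q.part x \ {x} = ∅ := by
      by_contra hQe
      exact hQ (mem_avoid_singleton.2
        ⟨Finset.nonempty_iff_ne_empty.2 hQe, _, Q.part_mem.2 hx, rfl⟩)
    -- `{x}` is then a part of `Q`; counting parts shows that it is one of `P` as well.
    rw [P.card_parts_eq_card_erase_avoid hx, Q.card_parts_eq_card_erase_avoid hx,
      Finset.erase_eq_of_notMem hQ, h] at hcard
    have hP : P.part x \ {x} ∉ (Q.avoid {x}).parts := fun hP ↦ by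
      have := Finset.card_erase_lt_of_mem hP
      omega
    have hPe : P.part x \ {x} = ∅ := by
      by_contra hPe
      exact hP (h ▸ mem_avoid_singleton.2
        ⟨Finset.nonempty_iff_ne_empty.2 hPe, _, P.part_mem.2 hx, rfl⟩)
    exact hne (eq_of_avoid_eq_of_part_eq hx h (hPe.trans hQe.symm))
  obtain ⟨-, D, hD, hDQ⟩ := mem_avoid_singleton.1 (h ▸ hmem)
  have hxD : x ∉ D := fun hxD ↦
    hne (eq_of_avoid_eq_of_part_eq hx h (by rw [← hDQ, P.part_eq_of_mem hD hxD]))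
  rw [sdiff_singleton_eq_of_notMem hxD] at hDQ
  rw [← hDQ, Finset.mem_erase]
  exact ⟨fun hD' ↦ hxD (hD' ▸ P.mem_part hx), hD⟩

lemma mem_part_iff_of_avoid_eq {P Q : Finpartition S} {y u v : α}
    (h : P.avoid {y} = Q.avoid {y}) (hu : u ≠ y) (hv : v ≠ y) (huv : u ∈ P.part v) :
    u ∈ Q.part v := by
  obtain ⟨D, hD, huD, hvD⟩ := P.mem_part_iff_exists.1 huv
  obtain ⟨D', hD', hDD'⟩ := avoid_singleton_congr h hD ⟨u, by simp [huD, hu]⟩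
  refine Q.mem_part_iff_exists.2 ⟨D', hD', ?_, ?_⟩
  · exact (Finset.mem_sdiff.1 (hDD' ▸ Finset.mem_sdiff.2 ⟨huD, by simpa⟩)).1
  · exact (Finset.mem_sdiff.1 (hDD' ▸ Finset.mem_sdiff.2 ⟨hvD, by simpa⟩)).1

/-- Distinct partitions with equally many parts differ by moving at most one point: any other such
point would have to be the only companion of `x` in both partitions. -/
lemma eq_of_avoid_eq_of_avoid_eq {P Q : Finpartition S} {x y : α} (hx : x ∈ S)
    (hPx : P.avoid {x} = Q.avoid {x}) (hPy : P.avoid {y} = Q.avoid {y})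
    (hcard : P.parts.card = Q.parts.card) (hne : P ≠ Q) : x = y := by
  by_contra hxy
  -- A companion of `x` in one partition that is not a companion in the other one must be `y`.
  have key : ∀ P Q : Finpartition S, P.avoid {x} = Q.avoid {x} → P.avoid {y} = Q.avoid {y} →
      P.parts.card = Q.parts.card → P ≠ Q → y ∈ Q.part x ∧ y ∉ P.part x := by
    intro P Q hPx hPy hcard hne
    have hB := part_sdiff_mem_of_avoid_eq hx hPx hcard hne
    rw [Finset.mem_erase] at hB
    obtain ⟨b, hb⟩ := P.nonempty_of_mem_parts hB.2
    have hbP : b ∉ P.part x := fun hbP ↦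
      hB.1 (P.eq_of_mem_parts hB.2 (P.part_mem.2 hx) hb hbP)
    obtain rfl : b = y := by
      by_contra hby
      exact hbP (mem_part_iff_of_avoid_eq hPy.symm hby hxy (Finset.mem_sdiff.1 hb).1)
    exact ⟨(Finset.mem_sdiff.1 hb).1, hbP⟩
  exact (key P Q hPx hPy hcard hne).2 (key Q P hPx.symm hPy.symm hcard.symm hne.symm).1

/-- Moving `x` to a part `B` that does not contain it, when `x` is not alone in its part. -/
lemma exists_move (P : Finpartition S) {x : α} (hx : x ∈ S) (hx' : (P.part x \ {x}).Nonempty)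
    {B : Finset α} (hB : B ∈ P.parts.erase (P.part x)) :
    ∃ Q : Finpartition S, P.avoid {x} = Q.avoid {x} ∧ Q.part x \ {x} = B ∧
      Q.parts.card = P.parts.card := by
  rw [Finset.mem_erase] at hB
  obtain ⟨hBx, hB⟩ := hB
  have hxB : x ∉ B := fun h ↦ hBx (P.part_eq_of_mem hB h).symm
  have hBS : insert x B ⊆ S := Finset.insert_subset hx (P.le hB)
  let Q : Finpartition S := (P.avoid (insert x B)).extend (b := insert x B)
    (Finset.insert_ne_empty x B) Finset.sdiff_disjoint (Finset.sdiff_union_of_subset hBS)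
  have hQ : ∀ C, C ∈ Q.parts ↔ C = insert x B ∨ ∃ D ∈ P.parts, ¬ D ⊆ insert x B ∧
      D \ insert x B = C := fun C ↦ by
    simp only [Q, extend_parts, Finset.mem_insert, mem_avoid]
  -- Away from `B`, the part `D` only loses the point `x`.
  have hD : ∀ D ∈ P.parts, D ≠ B → D \ insert x B = D \ {x} := fun D hD hne ↦ by
    ext z
    simp only [Finset.mem_sdiff, Finset.mem_insert, Finset.mem_singleton, not_or]
    exact ⟨fun h ↦ ⟨h.1, h.2.1⟩,
      fun h ↦ ⟨h.1, h.2, fun hz ↦ hne (P.eq_of_mem_parts hD hB h.1 hz)⟩⟩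
  have hpart : Q.part x = insert x B :=
    Q.part_eq_of_mem ((hQ _).2 (Or.inl rfl)) (Finset.mem_insert_self x B)
  have hpart' : Q.part x \ {x} = B := by
    rw [hpart, Finset.insert_sdiff_of_mem _ (Finset.mem_singleton_self x),
      sdiff_singleton_eq_of_notMem hxB]
  have havoid : P.avoid {x} = Q.avoid {x} := by
    ext C
    rw [mem_avoid_singleton, mem_avoid_singleton]
    refine and_congr_right fun hC ↦ ⟨?_, ?_⟩
    · rintro ⟨D, hDP, rfl⟩
      by_cases hDB : D = B
      · subst hDB
        exact ⟨_, (hQ _).2 (Or.inl rfl), by rw [← hpart, hpart',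
          sdiff_singleton_eq_of_notMem hxB]⟩
      · refine ⟨D \ insert x B, (hQ _).2 (Or.inr ⟨D, hDP, ?_, rfl⟩), ?_⟩
        · rw [← Finset.sdiff_nonempty, hD D hDP hDB]; exact hC
        · rw [hD D hDP hDB, sdiff_idem]
    · rintro ⟨D, hDQ, rfl⟩
      obtain rfl | ⟨D, hDP, hDs, rfl⟩ := (hQ _).1 hDQ
      · exact ⟨B, hB, by rw [← hpart, hpart', sdiff_singleton_eq_of_notMem hxB]⟩
      · have hDB : D ≠ B := by rintro rfl; exact hDs (Finset.subset_insert _ _)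
        exact ⟨D, hDP, by rw [hD D hDP hDB, sdiff_idem]⟩
  refine ⟨Q, havoid, hpart', ?_⟩
  rw [Q.card_parts_eq_card_erase_avoid hx, P.card_parts_eq_card_erase_avoid hx, ← havoid, hpart',
    Finset.card_erase_of_mem, Finset.card_erase_of_mem]
  · exact mem_avoid_singleton.2 ⟨hx', _, P.part_mem.2 hx, rfl⟩
  · exact mem_avoid_singleton.2 ⟨P.nonempty_of_mem_parts hB, B, hB,
      sdiff_singleton_eq_of_notMem hxB⟩

/-- Every part of `Q` contains the trace away from `x` of some part of `P`, provided the two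
partitions agree away from `x` and `x` is not alone in its part of `Q`. -/
lemma exists_sdiff_subset_of_avoid_eq {P Q : Finpartition S} {x : α}
    (h : P.avoid {x} = Q.avoid {x}) (hx : (Q.part x \ {x}).Nonempty) {C : Finset α}
    (hC : C ∈ Q.parts) : ∃ D ∈ P.parts, D \ {x} ⊆ C := by
  have hCx : (C \ {x}).Nonempty := by
    by_cases hxC : x ∈ C
    · rwa [← Q.part_eq_of_mem hC hxC]
    · rw [sdiff_singleton_eq_of_notMem hxC]
      exact Q.nonempty_of_mem_parts hC
  obtain ⟨D, hD, hDC⟩ := avoid_singleton_congr h.symm hC hCx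
  exact ⟨D, hD, hDC ▸ Finset.sdiff_subset⟩

end Finpartition

/-! ### Nonnegative vectors in a subspace of `ℝ^ι` -/

/-- Subtracting from `ν` the multiple of `μ` given by the minimal ratio `ν i / μ i` over `i ∈ E`
leaves a vector that is nonnegative on `E` and vanishes somewhere on `E`. -/
lemma exists_sub_smul_eq_zero {ι : Type*} {E : Finset ι} (hE : E.Nonempty) {μ ν : ι → ℝ}
    (hμ : ∀ i ∈ E, 0 < μ i) :
    ∃ s : ℝ, (∀ i ∈ E, 0 ≤ (ν - s • μ) i) ∧ ∃ i ∈ E, (ν - s • μ) i = 0 := by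
  obtain ⟨i₀, hi₀, hmin⟩ := E.exists_min_image (fun i ↦ ν i / μ i) hE
  refine ⟨ν i₀ / μ i₀, fun i hi ↦ ?_, i₀, hi₀, ?_⟩
  · have := (le_div_iff₀ (hμ i hi)).1 (hmin i hi)
    simpa using this
  · have := (hμ i₀ hi₀).ne'
    simp [this]

open Classical in
/-- Let a subspace `L` of `ℝ^ι` of dimension at least two contain a nonzero nonnegative vector.
Then at least `dim L` indices are zeros of nonzero nonnegative vectors of `L`.

Let `F` be the set of these indices and `e` an index outside `F`. If `m ∈ L` vanishes on `F` and
`m e ≤ 0`, the minimal ratio `s` of `m` to the given vector `l` outside `F` is at most zero, so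
`m - s • l` is nonnegative with a zero outside `F`, which forces `m = s • l`. Hence restriction to
`F ∪ {e}` is injective on `L`; if `dim L > |F|`, it is bijective, and `F` is nonempty because
`dim L ≥ 2`. A vector of `L` that vanishes on `F` but not at `e` then shows that `l` vanishes on `F`;
subtracting a multiple of `l` from a vector of `L` that equals one on `F` gives a nonzero nonnegative
vector with a zero outside `F`, contrary to the choice of `F`. -/
lemma finrank_le_card_exists_nonneg_apply_eq_zero {ι : Type*} [Fintype ι]
    (L : Submodule ℝ (ι → ℝ)) (hL : 2 ≤ Module.finrank ℝ L)
    {l : ι → ℝ} (hl : l ∈ L) (hl0 : 0 ≤ l) (hlne : l ≠ 0) :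
    Module.finrank ℝ L ≤
      (Finset.univ.filter fun i ↦ ∃ m ∈ L, 0 ≤ m ∧ m ≠ 0 ∧ m i = 0).card := by
  set F : Finset ι := Finset.univ.filter fun i ↦ ∃ m ∈ L, 0 ≤ m ∧ m ≠ 0 ∧ m i = 0 with hF
  have hmem : ∀ i, i ∈ F ↔ ∃ m ∈ L, 0 ≤ m ∧ m ≠ 0 ∧ m i = 0 := by simp [hF]
  by_contra! hlt
  have hE : (Fᶜ).Nonempty := by
    rw [Finset.nonempty_iff_ne_empty, Ne, Finset.compl_eq_empty_iff]
    intro hFu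
    have := Submodule.finrank_le L
    rw [Module.finrank_fintype_fun_eq_card] at this
    rw [hFu, Finset.card_univ] at hlt
    omega
  have hpos : ∀ m ∈ L, 0 ≤ m → m ≠ 0 → ∀ i ∈ Fᶜ, 0 < m i := fun m hm hm0 hne i hi ↦
    lt_of_le_of_ne (hm0 i) fun h ↦ Finset.mem_compl.1 hi ((hmem i).2 ⟨m, hm, hm0, hne, h.symm⟩)
  have hzero : ∀ m ∈ L, 0 ≤ m → ∀ i ∈ Fᶜ, m i = 0 → m = 0 := fun m hm hm0 i hi hmi ↦ by
    by_contra hne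
    exact (hpos m hm hm0 hne i hi).ne' hmi
  obtain ⟨e, he⟩ := hE
  have hprop : ∀ m ∈ L, (∀ i ∈ F, m i = 0) → m e ≤ 0 → ∃ s : ℝ, m = s • l := by
    intro m hm hmF hme
    obtain ⟨s, hs, i, hi, hsi⟩ := exists_sub_smul_eq_zero ⟨e, he⟩ (ν := m) (hpos l hl hl0 hlne)
    have hle := hpos l hl hl0 hlne e he
    -- Otherwise `m - s • l` would be negative at `e`.
    have hs0 : s ≤ 0 := by
      have := hs e he
      simp only [Pi.sub_apply, Pi.smul_apply, smul_eq_mul] at this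
      by_contra! hs0
      nlinarith [mul_pos hs0 hle]
    refine ⟨s, sub_eq_zero.1 (hzero _ (L.sub_mem hm (L.smul_mem s hl)) (fun j ↦ ?_) i hi hsi)⟩
    by_cases hj : j ∈ F
    · simpa [hmF j hj] using mul_nonpos_of_nonpos_of_nonneg hs0 (hl0 j)
    · exact hs j (Finset.mem_compl.2 hj)
  let R : L →ₗ[ℝ] ({i // i ∈ insert e F} → ℝ) :=
    (LinearMap.funLeft ℝ ℝ (fun i : {i // i ∈ insert e F} ↦ (i : ι))).comp L.subtype
  have hR : ∀ (m : L) (i : {i // i ∈ insert e F}), R m i = (m : ι → ℝ) i := fun _ _ ↦ rfl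
  have hRinj : Function.Injective R := by
    refine (injective_iff_map_eq_zero R).2 fun m hm ↦ Subtype.ext ?_
    have hm' : ∀ i ∈ insert e F, (m : ι → ℝ) i = 0 := fun i hi ↦ by
      rw [← hR m ⟨i, hi⟩, hm]; rfl
    have hme := hm' e (Finset.mem_insert_self e F)
    obtain ⟨s, hs⟩ := hprop m m.2 (fun i hi ↦ hm' i (Finset.mem_insert_of_mem hi)) hme.le
    have hse : s * l e = 0 := by rw [← hme, hs]; rfl
    rw [hs, (mul_eq_zero.1 hse).resolve_right (hpos l hl hl0 hlne e he).ne', zero_smul]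
    rfl
  have hcard : Module.finrank ℝ ({i // i ∈ insert e F} → ℝ) = F.card + 1 := by
    rw [Module.finrank_fintype_fun_eq_card, Fintype.card_coe,
      Finset.card_insert_of_notMem (Finset.mem_compl.1 he)]
  have hfin := LinearMap.finrank_le_finrank_of_injective hRinj
  have hRsurj : Function.Surjective R :=
    (LinearMap.injective_iff_surjective_of_finrank_eq_finrank (by omega)).1 hRinj
  have heF : ∀ i ∈ F, i ≠ e := fun i hi h ↦ Finset.mem_compl.1 he (h ▸ hi)
  have hlF : ∀ i ∈ F, l i = 0 := by
    obtain ⟨m, hm⟩ := hRsurj fun i ↦ if (i : ι) = e then -1 else 0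
    have hme : (m : ι → ℝ) e = -1 := by
      rw [← hR m ⟨e, Finset.mem_insert_self e F⟩, hm]; simp
    have hmF : ∀ i ∈ F, (m : ι → ℝ) i = 0 := fun i hi ↦ by
      rw [← hR m ⟨i, Finset.mem_insert_of_mem hi⟩, hm]; simp [heF i hi]
    obtain ⟨s, hs⟩ := hprop m m.2 hmF (by rw [hme]; norm_num)
    have hs0 : s ≠ 0 := by
      rintro rfl
      rw [hs] at hme
      simp at hme
    intro i hi
    have := hmF i hi
    rw [hs] at this
    exact (mul_eq_zero.1 this).resolve_left hs0
  obtain ⟨m, hm⟩ := hRsurj fun i ↦ if (i : ι) = e then 0 else 1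
  have hmF : ∀ i ∈ F, (m : ι → ℝ) i = 1 := fun i hi ↦ by
    rw [← hR m ⟨i, Finset.mem_insert_of_mem hi⟩, hm]; simp [heF i hi]
  obtain ⟨s, hs, i, hi, hsi⟩ :=
    exists_sub_smul_eq_zero ⟨e, he⟩ (ν := (m : ι → ℝ)) (hpos l hl hl0 hlne)
  have h0 := hzero _ (L.sub_mem m.2 (L.smul_mem s hl)) (fun j ↦ by
    by_cases hj : j ∈ F
    · simp [hmF j hj, hlF j hj]
    · exact hs j (Finset.mem_compl.2 hj)) i hi hsi
  obtain ⟨j, hj⟩ : F.Nonempty := Finset.card_pos.1 (by omega)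
  have := congrFun h0 j
  simp [hmF j hj, hlF j hj] at this

/-! ### Redundant points of a Tverberg partition -/

lemma sum_subtype_eq_sum_sdiff {E M : Type*} [DecidableEq E] [AddCommMonoid M] {S : Finset E}
    (A : Finset E) {f : S → M} {x : S}
    (hf : f x = 0) :
    ∑ i ∈ A.subtype (· ∈ S), f i = ∑ i ∈ (A \ {(x : E)}).subtype (· ∈ S), f i := by
  refine (Finset.sum_subset (fun i hi ↦ ?_) fun i hi hi' ↦ ?_).symm
  · simp only [Finset.mem_subtype, Finset.mem_sdiff] at hi ⊢
    exact hi.1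
  · simp only [Finset.mem_subtype, Finset.mem_sdiff, Finset.mem_singleton, not_and,
      not_not] at hi hi'
    rw [Subtype.ext (hi' hi), hf]

section Redundant

variable {E : Type*} [AddCommGroup E] [Module ℝ E] [DecidableEq E] {S : Finset E}

/-- The pair of the weighted vector sum and the total weight of the points of `S` lying in `C`,
as a linear function of the weights on `S`. -/
def weightedSum (S C : Finset E) : (S → ℝ) →ₗ[ℝ] E × ℝ :=
  ∑ x ∈ C.subtype (· ∈ S), (LinearMap.proj x).smulRight ((x : E), (1 : ℝ))

lemma weightedSum_fst (C : Finset E) (l : S → ℝ) :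
    (weightedSum S C l).1 = ∑ x ∈ C.subtype (· ∈ S), l x • (x : E) := by
  simp [weightedSum, Prod.fst_sum]

lemma weightedSum_snd (C : Finset E) (l : S → ℝ) :
    (weightedSum S C l).2 = ∑ x ∈ C.subtype (· ∈ S), l x := by
  simp [weightedSum, Prod.snd_sum]

/-- The weights on `S` with the same weighted vector sum and the same total weight on each part
of a partition. -/
def balancedWeights (P : Finpartition S) : Submodule ℝ (S → ℝ) :=
  ⨅ A ∈ P.parts, ⨅ B ∈ P.parts, LinearMap.eqLocus (weightedSum S A) (weightedSum S B)

lemma mem_balancedWeights {P : Finpartition S} {l : S → ℝ} :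
    l ∈ balancedWeights P ↔
      ∀ A ∈ P.parts, ∀ B ∈ P.parts, weightedSum S A l = weightedSum S B l := by
  simp [balancedWeights, Submodule.mem_iInf]

/-- Being balanced amounts to `(d + 1) (r - 1)` linear equations on the weights. -/
lemma card_le_finrank_balancedWeights_add [FiniteDimensional ℝ E] (P : Finpartition S) :
    S.card ≤ Module.finrank ℝ (balancedWeights P) +
      (Module.finrank ℝ E + 1) * (P.parts.card - 1) := by
  obtain hP | ⟨A₀, hA₀⟩ := P.parts.eq_empty_or_nonempty
  · have hS : S = ∅ := by simpa using P.parts_eq_empty_iff.1 hP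
    simp [hS]
  -- It suffices to compare every other part with `A₀`, which imposes `d + 1` equations per part.
  let Φ : (S → ℝ) →ₗ[ℝ] ({A // A ∈ P.parts.erase A₀} → E × ℝ) :=
    LinearMap.pi fun A ↦ weightedSum S A - weightedSum S A₀
  have hker : LinearMap.ker Φ ≤ balancedWeights P := by
    intro l hl
    have h0 : ∀ A ∈ P.parts, weightedSum S A l = weightedSum S A₀ l := by
      intro A hA
      by_cases hAA : A = A₀
      · rw [hAA]
      · exact sub_eq_zero.1 (congrFun (LinearMap.mem_ker.1 hl)
          ⟨A, Finset.mem_erase.2 ⟨hAA, hA⟩⟩)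
    exact mem_balancedWeights.2 fun A hA B hB ↦ (h0 A hA).trans (h0 B hB).symm
  have h1 := Φ.finrank_range_add_finrank_ker
  have h2 := Submodule.finrank_mono hker
  have h3 := Submodule.finrank_le (LinearMap.range Φ)
  rw [Module.finrank_fintype_fun_eq_card, Fintype.card_coe] at h1
  rw [Module.finrank_pi_fintype] at h3
  simp only [Module.finrank_prod, Module.finrank_self, Finset.sum_const, Finset.card_univ,
    Fintype.card_coe, Finset.card_erase_of_mem hA₀, smul_eq_mul] at h3
  rw [mul_comm] at h3
  omega

/-- A common point of the convex hulls of the parts provides balanced weights: the coefficients of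
convex combinations of the parts that are equal to that point. -/
lemma exists_mem_balancedWeights (P : Finpartition S) (hS : S.Nonempty)
    (hP : (⋂ A ∈ P.parts, convexHull ℝ (A : Set E)).Nonempty) :
    ∃ l ∈ balancedWeights P, 0 ≤ l ∧ l ≠ 0 := by
  obtain ⟨c, hc⟩ := hP
  simp only [Set.mem_iInter, Finset.mem_convexHull'] at hc
  choose! w hw0 hw1 hwc using hc
  let l : S → ℝ := fun x ↦ w (P.part x) x
  have hsum : ∀ A ∈ P.parts, weightedSum S A l = (c, 1) := by
    intro A hA
    have hl : ∀ x : S, (x : E) ∈ A → l x = w A x := fun x hx ↦ by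
      simp only [l, P.part_eq_of_mem hA hx]
    refine Prod.ext ?_ ?_
    · rw [weightedSum_fst, ← hwc A hA,
        ← Finset.sum_subtype_of_mem (fun y ↦ w A y • y) fun y hy ↦ P.le hA hy]
      exact Finset.sum_congr rfl fun x hx ↦ by rw [hl x (Finset.mem_subtype.1 hx)]
    · rw [weightedSum_snd, ← hw1 A hA, ← Finset.sum_subtype_of_mem (w A) fun y hy ↦ P.le hA hy]
      exact Finset.sum_congr rfl fun x hx ↦ by rw [hl x (Finset.mem_subtype.1 hx)]
  refine ⟨l, mem_balancedWeights.2 fun A hA B hB ↦ (hsum A hA).trans (hsum B hB).symm,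
    fun x ↦ hw0 _ (P.part_mem.2 x.2) _ (P.mem_part x.2), fun hl ↦ ?_⟩
  obtain ⟨x, hx⟩ := hS
  have := hsum _ (P.part_mem.2 hx)
  rw [hl, map_zero] at this
  simpa using congrArg Prod.snd this

/-- Normalizing nonnegative balanced weights that vanish at `x` gives a common point of the convex
hulls of the parts with `x` removed. -/
lemma nonempty_iInter_convexHull_sdiff {P : Finpartition S} {l : S → ℝ}
    (hl : l ∈ balancedWeights P) (hl0 : 0 ≤ l) (hlne : l ≠ 0) {x : S} (hx : l x = 0) :
    (⋂ A ∈ P.parts, convexHull ℝ (((A \ {(x : E)} : Finset E)) : Set E)).Nonempty := by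
  rw [mem_balancedWeights] at hl
  obtain ⟨y, hy⟩ := Function.ne_iff.1 hlne
  have hA₀ := P.part_mem.2 y.2
  set p := weightedSum S (P.part y) l with hp
  have hpos : 0 < p.2 := by
    rw [hp, weightedSum_snd]
    refine Finset.sum_pos' (fun i _ ↦ hl0 i) ⟨y, ?_, lt_of_le_of_ne (hl0 y) (Ne.symm hy)⟩
    simp
  refine ⟨p.2⁻¹ • p.1, Set.mem_iInter₂.2 fun A hA ↦ ?_⟩
  have hpA : p = weightedSum S A l := hl _ hA₀ A hA
  have h1 : p.1 = ∑ i ∈ (A \ {(x : E)}).subtype (· ∈ S), l i • (i : E) := by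
    rw [hpA, weightedSum_fst, sum_subtype_eq_sum_sdiff A (by rw [hx, zero_smul])]
  have h2 : p.2 = ∑ i ∈ (A \ {(x : E)}).subtype (· ∈ S), l i := by
    rw [hpA, weightedSum_snd, sum_subtype_eq_sum_sdiff A hx]
  rw [h2] at hpos
  have := Finset.centerMass_mem_convexHull (R := ℝ)
    (s := ((A \ {(x : E)} : Finset E) : Set E)) _ (fun i _ ↦ hl0 i) hpos
    (z := fun i : S ↦ (i : E)) fun i hi ↦ Finset.mem_subtype.1 hi
  rwa [Finset.centerMass, ← h1, ← h2] at this

/-- A point of `S` is redundant for a Tverberg partition if the hulls of the parts still meet once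
it is removed. When `S` exceeds the Tverberg number, at most `(d + 1) (r - 1)` points are not
redundant. -/
lemma card_sub_le_card_redundant [FiniteDimensional ℝ E] (P : Finpartition S)
    (hP : (⋂ A ∈ P.parts, convexHull ℝ (A : Set E)).Nonempty)
    (hS : (Module.finrank ℝ E + 1) * (P.parts.card - 1) + 2 ≤ S.card)
    {F : Finset E} (hF : ∀ x ∈ S,
      (⋂ A ∈ P.parts, convexHull ℝ ((A \ {x} : Finset E) : Set E)).Nonempty → x ∈ F) :
    S.card - (Module.finrank ℝ E + 1) * (P.parts.card - 1) ≤ F.card := by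
  classical
  have hdim := card_le_finrank_balancedWeights_add P
  obtain ⟨l, hl, hl0, hlne⟩ := exists_mem_balancedWeights P (Finset.card_pos.1 (by omega)) hP
  have hle := finrank_le_card_exists_nonneg_apply_eq_zero (balancedWeights P) (by omega) hl hl0 hlne
  have hsub := Finset.card_le_card_of_injOn (t := F) (fun x : S ↦ (x : E))
    (s := Finset.univ.filter fun x : S ↦ ∃ m ∈ balancedWeights P, 0 ≤ m ∧ m ≠ 0 ∧ m x = 0)
    (fun x hx ↦ by
      obtain ⟨m, hm, hm0, hmne, hmx⟩ := (Finset.mem_filter.1 hx).2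
      exact hF x x.2 (nonempty_iInter_convexHull_sdiff hm hm0 hmne hmx))
    Subtype.val_injective.injOn
  have := hle.trans (by convert hsub)
  omega

end Redundant

/-! ### Degrees in the Tverberg partition graph -/

section Degree

variable {d r : ℕ} {S : Finset (EuclideanSpace ℝ (Fin d))}

lemma TverbergPartition.card_parts (P : TverbergPartition S r) : P.1.parts.card = r :=
  P.2.1

/-- The uniqueness of the removed point in the definition of adjacency holds automatically. -/
lemma tverbergGraph_adj_iff {P Q : TverbergPartition S r} :
    (tverbergGraph S r).Adj P Q ↔ P ≠ Q ∧ ∃ x ∈ S, P.1.avoid {x} = Q.1.avoid {x} := by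
  constructor
  · rintro ⟨hne, x, ⟨hx, h⟩, -⟩
    exact ⟨hne, x, hx, h⟩
  · rintro ⟨hne, x, hx, h⟩
    refine ⟨hne, x, ⟨hx, h⟩, fun y hy ↦ ?_⟩
    exact Finpartition.eq_of_avoid_eq_of_avoid_eq hy.1 hy.2 h (P.2.1.trans Q.2.1.symm)
      fun h ↦ hne (Subtype.ext h)

end Degree

theorem mainTheorem2 (d r n : ℕ) (hd : 1 ≤ d) (hr : 1 ≤ r)
    (S : Finset (EuclideanSpace ℝ (Fin d))) (hS : S.card = n) (hn : Tv d r < n)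
    (v : TverbergPartition S r) :
    (n + 1 - Tv d r) * (r - 1) ≤ (tverbergGraph S r).degree v ∧
      (tverbergGraph S r).degree v ≤ n * (r - 1) := by
  classical
  -- A neighbour `Q` is encoded by the moved point `x` and the part of `v` that receives it.
  have hex : ∀ Q ∈ (tverbergGraph S r).neighborFinset v,
      v ≠ Q ∧ ∃ x ∈ S, v.1.avoid {x} = Q.1.avoid {x} := fun Q hQ ↦
    tverbergGraph_adj_iff.1 ((SimpleGraph.mem_neighborFinset _ _ _).1 hQ)
  choose! hne x hxS hx using hex
  have hne' : ∀ Q ∈ (tverbergGraph S r).neighborFinset v, v.1 ≠ Q.1 := fun Q hQ h ↦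
    hne Q hQ (Subtype.ext h)
  have hcard : ∀ Q : TverbergPartition S r, v.1.parts.card = Q.1.parts.card := fun Q ↦
    v.card_parts.trans Q.card_parts.symm
  let f : TverbergPartition S r →
      (_ : EuclideanSpace ℝ (Fin d)) × Finset (EuclideanSpace ℝ (Fin d)) :=
    fun Q ↦ ⟨x Q, Q.1.part (x Q) \ {x Q}⟩
  have hsigma : ∀ F ⊆ S, (F.sigma fun y ↦ v.1.parts.erase (v.1.part y)).card =
      F.card * (r - 1) := fun F hF ↦ by
    rw [Finset.card_sigma, Finset.sum_congr rfl fun y hy ↦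
      (Finset.card_erase_of_mem (v.1.part_mem.2 (hF hy))), v.card_parts, Finset.sum_const,
      smul_eq_mul]
  rw [← SimpleGraph.card_neighborFinset_eq_degree]
  constructor
  · set F := S.filter fun y ↦
      (⋂ A ∈ v.1.parts, convexHull ℝ
        ((A \ {y} : Finset (EuclideanSpace ℝ (Fin d))) :
          Set (EuclideanSpace ℝ (Fin d)))).Nonempty with hF
    have hTv : Tv d r = (d + 1) * (r - 1) + 1 := rfl
    have hred : n + 1 - Tv d r ≤ F.card := by
      have := card_sub_le_card_redundant v.1 v.2.2 (F := F)
        (by rw [finrank_euclideanSpace_fin, v.card_parts]; omega)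
        (fun y hy h ↦ Finset.mem_filter.2 ⟨hy, h⟩)
      rw [finrank_euclideanSpace_fin, v.card_parts] at this
      omega
    refine (Nat.mul_le_mul_right _ hred).trans ?_
    rw [← hsigma F (Finset.filter_subset _ _)]
    refine Finset.card_le_card_of_surjOn f ?_
    rintro ⟨y, B⟩ hyB
    obtain ⟨hyF, hB⟩ := Finset.mem_sigma.1 hyB
    obtain ⟨hyS, c, hc⟩ := Finset.mem_filter.1 hyF
    rw [Set.mem_iInter₂] at hc
    have hy1 : (v.1.part y \ {y}).Nonempty := by
      have := convexHull_nonempty_iff.1 ⟨c, hc _ (v.1.part_mem.2 hyS)⟩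
      exact_mod_cast this
    obtain ⟨Q, hQ, hQB, hQr⟩ := v.1.exists_move hyS hy1 hB
    have hB' := Finset.mem_erase.1 hB
    have hBne := v.1.nonempty_of_mem_parts hB'.2
    -- The common point `c` of the hulls with `y` removed lies in the hull of every part of `Q`.
    let Q' : TverbergPartition S r := ⟨Q, hQr.trans v.card_parts, c, Set.mem_iInter₂.2 fun C hC ↦ by
      obtain ⟨D, hD, hDC⟩ := Finpartition.exists_sdiff_subset_of_avoid_eq hQ (hQB ▸ hBne) hC
      exact convexHull_mono (Finset.coe_subset.2 hDC) (hc D hD)⟩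
    have hvQ : v ≠ Q' := by
      intro h
      have hvQ : v.1 = Q := congrArg Subtype.val h
      obtain ⟨b, hb⟩ := hBne
      refine hB'.1 (v.1.eq_of_mem_parts hB'.2 (v.1.part_mem.2 hyS) hb ?_)
      rw [← hQB, ← hvQ] at hb
      exact (Finset.mem_sdiff.1 hb).1
    have hadj : Q' ∈ (tverbergGraph S r).neighborFinset v :=
      (SimpleGraph.mem_neighborFinset _ _ _).2 (tverbergGraph_adj_iff.2 ⟨hvQ, y, hyS, hQ⟩)
    have hxy : x Q' = y := Finpartition.eq_of_avoid_eq_of_avoid_eq (hxS Q' hadj) (hx Q' hadj) hQ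
      (hcard Q') (hne' Q' hadj)
    refine ⟨Q', hadj, ?_⟩
    simp only [f, hxy, Q', hQB]
  · rw [← hS, ← hsigma S subset_rfl]
    refine Finset.card_le_card_of_injOn f (fun Q hQ ↦ ?_) fun Q hQ Q' hQ' h ↦ ?_
    · exact Finset.mem_sigma.2 ⟨hxS Q hQ, Finpartition.part_sdiff_mem_of_avoid_eq (hxS Q hQ)
        (hx Q hQ) (hcard Q) (hne' Q hQ)⟩
    · obtain ⟨h1, h2⟩ := Sigma.mk.inj_iff.1 h
      have h2 := eq_of_heq h2
      refine Subtype.ext (Finpartition.eq_of_avoid_eq_of_part_eq (hxS Q hQ) ?_ ?_)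
      · rw [← hx Q hQ, h1, hx Q' hQ']
      · rw [h2, h1]
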